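/- **Setting.** Let $a<b$, $T>0$, $1<\beta<2$, $\lambda\ge 0$. Let $\gamma_1,\gamma_2,\gamma_3$ satisfy $\gamma_1+\gamma_2+\gamma_3=1$, $\gamma_1-\gamma_3=\beta/2$ and one of the following three conditions (which are equivalent given these two equations), where $q=\beta^2+3\beta$: 1. $\max\left\{\frac{2(q-4)}{q+2},\frac{q}{q+4}\right\}<\gamma_1<\frac{3(q-2)}{2(q+2)}$; 2. $\frac{(\beta-4)(q+2)+24}{2(q+2)}<\gamma_2<\min\left\{\frac{(\beta-2)(q+4)+16}{2(q+4)},\frac{(\beta-6)(q+2)+48}{2(q+2)}\right\}$; 3. $\max\left\{\frac{(2-\beta)(\beta^2+\beta-8)}{2(q+2)},\frac{(1-\beta)(\beta^2+2\beta)}{2(q+4)}\right\}<\gamma_3<\frac{(2-\beta)(\beta^2+2\beta-3)}{2(q+2)}$. For integers $N,M\ge 1$ put $h=\frac{b-a}{N+1}$, $\Delta t=\frac TM$, $x_i=a+ih$. Let $w_0=1$, $w_k=\left(1-\frac{1+\beta}{k}\right)w_{k-1}$ for $k\ge 1$, and $$g_0=\gamma_1w_0e^{h\lambda},\qquad g_1=\gamma_1w_1+\gamma_2w_0,\qquad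 g_k=(\gamma_1w_k+\gamma_2w_{k-1}+\gamma_3w_{k-2})e^{-(k-1)h\lambda}\quad(k\ge2),$$ $$\rho=(\gamma_1e^{h\lambda}+\gamma_2+\gamma_3e^{-h\lambda})(1-e^{-h\lambda})^\beta .$$ Let $G\in\mathbb R^{N\times N}$ be the symmetric Toeplitz matrix with first column $$-\frac{\Delta t}{2h^\beta}\left(2(g_1-\rho),\,g_0+g_2,\,g_3,\dots,g_N\right)^T,$$ and let $\tau(G)=G-HC(G)$, where $HC(G)$ is the symmetric Hankel matrix with first column $-\frac{\Delta t}{2h^\beta}(g_3,\dots,g_N,0,0)^T$ and last column $-\frac{\Delta t}{2h^\beta}(0,0,g_N,\dots,g_3)^T$ (so $HC(G)=0$ if $N\le 2$). For a function $d$ on $[a,b]$ with $d\ge 0$ put $d_i=d(x_i)$, $K_i=I+d_iG$, $G_i=I+d_i\tau(G)$, and $$P_1^{-1}=\sum_{i=1}^Ne_ie_i^TK_i^{-1},\qquad P_2^{-1}=\sum_{i=1}^Ne_ie_i^TG_i^{-1},$$ where $e_1,\dots,e_N$ is the standard basis of $\mathbb R^N$. Write $\|\cdot\|_\infty$ for the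 maximal absolute row sum of a matrix. **Theorem 4.1.** Let $a,b,T,\beta,\lambda,\gamma_1,\gamma_2,\gamma_3$ be as above and let $C\in\mathbb R$. There is a constant $c_2>0$ such that for every $\varepsilon>0$ there is $\varsigma\in\mathbb N$ with the following property. For all integers $N,M\ge 1$ and every function $d\ge 0$ on $[a,b]$ with $d(x_i)\,\Delta t/h^\beta\le C$ for $i=1,\dots,N$, all the matrices $K_i$ and $G_i$ are invertible, and there are $E_2,F_2\in\mathbb R^{N\times N}$ with $$P_2^{-1}-P_1^{-1}=E_2+F_2,\qquad \|E_2\|_\infty<c_2\,\varepsilon,\qquad \operatorname{rank}(F_2)\le 4\varsigma .$$ In particular $c_2$ does not depend on $\varepsilon,N,M,d$, and $\varsigma$ does not depend on $N,M,d$. -/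

import Mathlib

open Matrix

-- ‖A‖ for a matrix is the operator norm induced by the sup norm on vectors,
-- i.e. the maximal absolute row sum ‖A‖_∞.
attribute [local instance] Matrix.linftyOpNormedAddCommGroup

namespace TemperedFDE

noncomputable section

/-- The data of the equation and of the scheme that do not depend on the mesh: the space interval
`[a, b]`, the final time `T`, the order `β`, the tempering parameter `lam`, and the three weights
of the tempered weighted and shifted Grünwald formula. -/
structure Params where
  a : ℝ
  b : ℝ
  T : ℝ
  β : ℝ
  lam : ℝ
  γ₁ : ℝ
  γ₂ : ℝ
  γ₃ : ℝ

/-- The standing assumptions on the data. The weights solve the two linear equations and lie in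
one of the three ranges (which describe the same set in terms of `γ₁`, `γ₂` or `γ₃`). -/
structure Params.Admissible (p : Params) : Prop where
  a_lt_b : p.a < p.b
  T_pos : 0 < p.T
  one_lt_β : 1 < p.β
  β_lt_two : p.β < 2
  lam_nonneg : 0 ≤ p.lam
  sum_γ : p.γ₁ + p.γ₂ + p.γ₃ = 1
  diff_γ : p.γ₁ - p.γ₃ = p.β / 2
  range_γ :
    (max (2 * (p.β ^ 2 + 3 * p.β - 4) / (p.β ^ 2 + 3 * p.β + 2))
          ((p.β ^ 2 + 3 * p.β) / (p.β ^ 2 + 3 * p.β + 4)) < p.γ₁ ∧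
      p.γ₁ < 3 * (p.β ^ 2 + 3 * p.β - 2) / (2 * (p.β ^ 2 + 3 * p.β + 2))) ∨
    (((p.β - 4) * (p.β ^ 2 + 3 * p.β + 2) + 24) / (2 * (p.β ^ 2 + 3 * p.β + 2)) < p.γ₂ ∧
      p.γ₂ < min
        (((p.β - 2) * (p.β ^ 2 + 3 * p.β + 4) + 16) / (2 * (p.β ^ 2 + 3 * p.β + 4)))
        (((p.β - 6) * (p.β ^ 2 + 3 * p.β + 2) + 48) / (2 * (p.β ^ 2 + 3 * p.β + 2)))) ∨
    (max ((2 - p.β) * (p.β ^ 2 + p.β - 8) / (2 * (p.β ^ 2 + 3 * p.β + 2)))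
          ((1 - p.β) * (p.β ^ 2 + 2 * p.β) / (2 * (p.β ^ 2 + 3 * p.β + 4))) < p.γ₃ ∧
      p.γ₃ < (2 - p.β) * (p.β ^ 2 + 2 * p.β - 3) / (2 * (p.β ^ 2 + 3 * p.β + 2)))

/-- The Grünwald coefficients `w_k` of order `β`. -/
def grunwald (β : ℝ) : ℕ → ℝ
  | 0 => 1
  | k + 1 => (1 - (1 + β) / ((k : ℝ) + 1)) * grunwald β k

namespace Params

variable (p : Params)

/-- The space step `h` for `N` interior grid points. -/
def h (N : ℕ) : ℝ := (p.b - p.a) / ((N : ℝ) + 1)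

/-- The time step for `M` time levels. -/
def dt (M : ℕ) : ℝ := p.T / (M : ℝ)

/-- The interior grid points `x_1, …, x_N`; the index `i : Fin N` stands for `x_{i+1}`. -/
def x (N : ℕ) (i : Fin N) : ℝ := p.a + ((i : ℝ) + 1) * p.h N

/-- The tempered weighted and shifted Grünwald weights `g_k`. -/
def g (N : ℕ) : ℕ → ℝ
  | 0 => p.γ₁ * grunwald p.β 0 * Real.exp (p.h N * p.lam)
  | 1 => p.γ₁ * grunwald p.β 1 + p.γ₂ * grunwald p.β 0
  | k + 2 =>
      (p.γ₁ * grunwald p.β (k + 2) + p.γ₂ * grunwald p.β (k + 1) + p.γ₃ * grunwald p.β k) *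
        Real.exp (-((k : ℝ) + 1) * p.h N * p.lam)

/-- The correction `ρ` of the diagonal. -/
def ρ (N : ℕ) : ℝ :=
  (p.γ₁ * Real.exp (p.h N * p.lam) + p.γ₂ + p.γ₃ * Real.exp (-(p.h N * p.lam))) *
    (1 - Real.exp (-(p.h N * p.lam))) ^ p.β

/-- The lower Hessenberg Toeplitz matrix of the left-sided tempered derivative, scaled by
`-Δt / (2 h^β)`: the entry is `g_{i-j+1}` for `j ≤ i + 1` and `0` above, with `ρ` subtracted
on the diagonal. -/
def Gβ (N M : ℕ) : Matrix (Fin N) (Fin N) ℝ :=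
  Matrix.of fun i j =>
    -(p.dt M / (2 * p.h N ^ p.β)) *
      ((if (j : ℕ) ≤ (i : ℕ) + 1 then p.g N ((i : ℕ) + 1 - (j : ℕ)) else 0) -
        (if i = j then p.ρ N else 0))

/-- The symmetric Toeplitz matrix `G`; the coefficient matrix of the scheme is `I + D G`. -/
def G (N M : ℕ) : Matrix (Fin N) (Fin N) ℝ := p.Gβ N M + (p.Gβ N M)ᵀ

/-- The symmetric Hankel matrix `HC(G)` with first column
`-Δt/(2h^β) (g_3, …, g_N, 0, 0)` and last column `-Δt/(2h^β) (0, 0, g_N, …, g_3)`. -/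
def HC (N M : ℕ) : Matrix (Fin N) (Fin N) ℝ :=
  Matrix.of fun i j =>
    -(p.dt M / (2 * p.h N ^ p.β)) *
      (if (i : ℕ) + (j : ℕ) + 2 < N then p.g N ((i : ℕ) + (j : ℕ) + 3)
       else if N < (i : ℕ) + (j : ℕ) then p.g N (2 * N + 1 - ((i : ℕ) + (j : ℕ)))
       else 0)

/-- The τ-matrix approximation of `G`. -/
def tauG (N M : ℕ) : Matrix (Fin N) (Fin N) ℝ := p.G N M - p.HC N M

variable (d : ℝ → ℝ)

/-- `K_i = I + d_i G` with `d_i = d(x_i)`. -/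
def K (N M : ℕ) (i : Fin N) : Matrix (Fin N) (Fin N) ℝ := 1 + d (p.x N i) • p.G N M

/-- `G_i = I + d_i τ(G)` with `d_i = d(x_i)`. -/
def Gtau (N M : ℕ) (i : Fin N) : Matrix (Fin N) (Fin N) ℝ := 1 + d (p.x N i) • p.tauG N M

/-- `P_1^{-1} = ∑ e_i e_iᵀ K_i^{-1}`. -/
def P₁inv (N M : ℕ) : Matrix (Fin N) (Fin N) ℝ :=
  ∑ i, vecMulVec (Pi.single i 1) (Pi.single i 1) * (p.K d N M i)⁻¹

/-- `P_2^{-1} = ∑ e_i e_iᵀ G_i^{-1}`. -/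
def P₂inv (N M : ℕ) : Matrix (Fin N) (Fin N) ℝ :=
  ∑ i, vecMulVec (Pi.single i 1) (Pi.single i 1) * (p.Gtau d N M i)⁻¹

end Params

end

end TemperedFDE

/-! Row `i` of `P₂⁻¹ - P₁⁻¹` is row `i` of `X = G_i⁻¹ - K_i⁻¹`. So it suffices that the rows of `X`
at distance at least `R` from both ends are small, with `R` independent of the mesh: these rows form
`E₂`, and the at most `2R` others form `F₂`.

The signs of the weights, and their generating function at `z = exp(-hλ)`, which produces `ρ`, make
`K_i` and `G_i` diagonally dominant with excess 1. Hence their inverses have absolute row sums at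
most 1 (`rowSum_inv_le_one`). For `G_i` this uses that, on each side of the diagonal, the Toeplitz
and Hankel weights of a row are distinct terms of one nonnegative sequence
(`sum_toep_add_hankel_le`).

Now `G_i X = (K_i - G_i) K_i⁻¹`, where `K_i - G_i` is a Hankel matrix concentrated in two corners.
The row sums `y` of `|X|` therefore satisfy `(1 + δ) y_a ≤ ∑ A_ab y_b + t_a`, where `A` has row sums
at most `δ ≤ Λ` and little mass outside a band of width `m`, and `t` is small in the interior. Every
`m` steps inward gain a factor `Λ/(1+Λ)`, up to a small error (`interior_decay`). Summability of the
untempered weights makes all this uniform in the mesh. -/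

namespace Matrix

/-! ### Row sums and diagonal dominance -/

variable {n : Type*} [Fintype n]

/-- Comparison of absolute row sums along a linear system `A * X = B`. -/
theorem diag_mul_rowSum_le [DecidableEq n] {A X B : Matrix n n ℝ} (h : A * X = B) (i : n) :
    A i i * ∑ j, |X i j| ≤
      ∑ k ∈ Finset.univ.erase i, |A i k| * ∑ j, |X k j| + ∑ j, |B i j| := by
  have key : ∀ j, A i i * |X i j| ≤
      ∑ k ∈ Finset.univ.erase i, |A i k| * |X k j| + |B i j| := by
    intro j
    have h1 : A i i * X i j = B i j - ∑ k ∈ Finset.univ.erase i, A i k * X k j := by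
      rw [← h, Matrix.mul_apply, ← Finset.add_sum_erase _ _ (Finset.mem_univ i)]
      ring
    calc A i i * |X i j| ≤ |A i i| * |X i j| :=
          mul_le_mul_of_nonneg_right (le_abs_self _) (abs_nonneg _)
      _ = |B i j - ∑ k ∈ Finset.univ.erase i, A i k * X k j| := by rw [← abs_mul, h1]
      _ ≤ |B i j| + |∑ k ∈ Finset.univ.erase i, A i k * X k j| := abs_sub _ _
      _ ≤ |B i j| + ∑ k ∈ Finset.univ.erase i, |A i k| * |X k j| := by
          gcongr
          refine (Finset.abs_sum_le_sum_abs _ _).trans (le_of_eq ?_)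
          simp [abs_mul]
      _ = _ := add_comm _ _
  calc A i i * ∑ j, |X i j| = ∑ j, A i i * |X i j| := Finset.mul_sum _ _ _
    _ ≤ ∑ j, (∑ k ∈ Finset.univ.erase i, |A i k| * |X k j| + |B i j|) :=
        Finset.sum_le_sum fun j _ => key j
    _ = _ := by
        rw [Finset.sum_add_distrib, Finset.sum_comm]
        simp [Finset.mul_sum]

theorem isUnit_of_diag_dominant [DecidableEq n] {A : Matrix n n ℝ}
    (h : ∀ i, 1 + ∑ k ∈ Finset.univ.erase i, |A i k| ≤ A i i) : IsUnit A := by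
  rw [Matrix.isUnit_iff_isUnit_det, isUnit_iff_ne_zero]
  refine det_ne_zero_of_sum_row_lt_diag fun i => ?_
  have := h i
  simp only [Real.norm_eq_abs]
  linarith [le_abs_self (A i i)]

/-- A matrix whose diagonal dominates the rest of each row by `1` has an inverse of maximal
absolute row sum at most `1`. -/
theorem rowSum_inv_le_one [DecidableEq n] {A : Matrix n n ℝ}
    (h : ∀ i, 1 + ∑ k ∈ Finset.univ.erase i, |A i k| ≤ A i i) (i : n) :
    ∑ j, |A⁻¹ i j| ≤ 1 := by
  have hu := (Matrix.isUnit_iff_isUnit_det A).1 (isUnit_of_diag_dominant h)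
  -- In the row `m` of largest sum `s`, the identity `A * A⁻¹ = 1` gives `A m m * s ≤ (A m m - 1) *
  -- s + 1`, that is `s ≤ 1`.
  obtain ⟨m, -, hm⟩ := Finset.exists_max_image Finset.univ (fun i => ∑ j, |A⁻¹ i j|)
    ⟨i, Finset.mem_univ i⟩
  refine (hm i (Finset.mem_univ i)).trans ?_
  have h1 := diag_mul_rowSum_le (Matrix.mul_nonsing_inv A hu) m
  have h2 : ∑ j, |(1 : Matrix n n ℝ) m j| = 1 := by
    rw [Finset.sum_eq_single m] <;> simp +contextual [eq_comm]
  have h3 : ∑ k ∈ Finset.univ.erase m, |A m k| * ∑ j, |A⁻¹ k j| ≤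
      (A m m - 1) * ∑ j, |A⁻¹ m j| := by
    calc _ ≤ ∑ k ∈ Finset.univ.erase m, |A m k| * ∑ j, |A⁻¹ m j| :=
          Finset.sum_le_sum fun k _ =>
            mul_le_mul_of_nonneg_left (hm k (Finset.mem_univ k)) (abs_nonneg _)
      _ = (∑ k ∈ Finset.univ.erase m, |A m k|) * ∑ j, |A⁻¹ m j| := by rw [Finset.sum_mul]
      _ ≤ _ := mul_le_mul_of_nonneg_right (by linarith [h m])
          (Finset.sum_nonneg fun _ _ => abs_nonneg _)
  rw [h2] at h1
  linarith

theorem rowSum_mul_le {A B : Matrix n n ℝ} (h : ∀ i, ∑ j, |B i j| ≤ 1) (i : n) :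
    ∑ j, |(A * B) i j| ≤ ∑ j, |A i j| := by
  calc ∑ j, |(A * B) i j| ≤ ∑ j, ∑ k, |A i k| * |B k j| :=
        Finset.sum_le_sum fun j _ => by
          rw [Matrix.mul_apply]
          exact (Finset.abs_sum_le_sum_abs _ _).trans (by simp [abs_mul])
    _ = ∑ k, |A i k| * ∑ j, |B k j| := by
        rw [Finset.sum_comm]; simp [Finset.mul_sum]
    _ ≤ ∑ k, |A i k| :=
        Finset.sum_le_sum fun k _ => mul_le_of_le_one_right (abs_nonneg _) (h k)

theorem linfty_opNorm_lt {A : Matrix n n ℝ} {r : ℝ} (hr : 0 < r)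
    (h : ∀ i, ∑ j, |A i j| < r) : ‖A‖ < r := by
  lift r to NNReal using hr.le
  rw [Matrix.linfty_opNorm_def, NNReal.coe_lt_coe, Finset.sup_lt_iff (by simpa using hr)]
  intro i _
  rw [← NNReal.coe_lt_coe]
  simpa using h i

theorem rank_le_card_of_rows_eq_zero [DecidableEq n] {A : Matrix n n ℝ} (s : Finset n)
    (h : ∀ i ∉ s, ∀ j, A i j = 0) : A.rank ≤ s.card := by
  have h1 : A = Matrix.diagonal (fun i => if i ∈ s then (1 : ℝ) else 0) * A := by
    ext i j
    by_cases hi : i ∈ s <;> simp [hi, h]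
  rw [h1]
  refine (Matrix.rank_mul_le_left _ _).trans ?_
  rw [Matrix.rank_diagonal]
  simp

theorem sum_vecMulVec_single_mul_apply [DecidableEq n] (A : n → Matrix n n ℝ) (i j : n) :
    (∑ k, vecMulVec (Pi.single k 1) (Pi.single k 1) * A k : Matrix n n ℝ) i j = A i i j := by
  rw [Matrix.sum_apply, Finset.sum_eq_single i]
  · simp [Matrix.mul_apply, vecMulVec_apply, Pi.single_apply]
  · intro k _ hk
    simp [Matrix.mul_apply, vecMulVec_apply, Pi.single_apply, hk.symm]
  · simp

end Matrix

/-! ### Boundary rows and scalar comparison -/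

theorem card_fin_near_boundary (N R : ℕ) :
    (Finset.univ.filter fun i : Fin N => (i : ℕ) < R ∨ N ≤ (i : ℕ) + R).card ≤ 2 * R := by
  rw [Finset.filter_or]
  refine (Finset.card_union_le _ _).trans ?_
  have h1 : (Finset.univ.filter fun i : Fin N => (i : ℕ) < R).card ≤ (Finset.range R).card :=
    Finset.card_le_card_of_injOn (fun i => (i : ℕ)) (fun i hi => by simpa using hi)
      (fun i _ j _ h => Fin.ext h)
  have h2 : (Finset.univ.filter fun i : Fin N => N ≤ (i : ℕ) + R).card ≤
      (Finset.range R).card :=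
    Finset.card_le_card_of_injOn (fun i => N - 1 - (i : ℕ))
      (fun i hi => by
        have := i.2
        simp only [Finset.coe_filter, Finset.mem_univ, true_and, Set.mem_ofPred_eq] at hi
        simp only [Finset.coe_range, Set.mem_Iio]; omega)
      (fun i _ j _ h => Fin.ext (by have := i.2; have := j.2; simp only at h; omega))
  simp only [Finset.card_range] at h1 h2
  omega

/-- Rows far from the boundary decay: a scalar comparison argument for diagonally dominant
systems whose off-band mass and whose interior right-hand side are small. -/
theorem interior_decay {N m : ℕ} {Λ τ : ℝ} (hΛ : 0 ≤ Λ) (hτ : 0 ≤ τ)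
    {A : Fin N → Fin N → ℝ} (hA : ∀ i j, 0 ≤ A i j) {δ y t : Fin N → ℝ}
    (hδ : ∀ i, δ i ≤ Λ) (hy : ∀ i, y i ≤ 2)
    (hsum : ∀ i, ∑ j ∈ Finset.univ.erase i, A i j ≤ δ i)
    (hoff : ∀ i : Fin N, ∑ j ∈ (Finset.univ.erase i).filter
      (fun j : Fin N => (i : ℕ) + m < j ∨ (j : ℕ) + m < i), A i j ≤ τ)
    (ht : ∀ i : Fin N, m ≤ (i : ℕ) → (i : ℕ) + m < N → t i ≤ τ)
    (hle : ∀ i, (1 + δ i) * y i ≤ ∑ j ∈ Finset.univ.erase i, A i j * y j + t i) (n : ℕ) :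
    ∀ i : Fin N, n * m ≤ (i : ℕ) → (i : ℕ) + n * m < N →
      y i ≤ 2 * (Λ / (1 + Λ)) ^ n + 3 * τ * (1 + Λ) := by
  induction n with
  | zero =>
    intro i _ _
    have := hy i
    have : 0 ≤ 3 * τ * (1 + Λ) := by positivity
    simp; linarith
  | succ n ih =>
    intro i h1 h2
    set r := Λ / (1 + Λ) with hr
    set b := 2 * r ^ n + 3 * τ * (1 + Λ) with hb
    have hr0 : 0 ≤ r := by positivity
    have hb0 : 0 ≤ b := by positivity
    rw [Nat.succ_mul] at h1 h2
    have hδ0 : 0 ≤ δ i := (Finset.sum_nonneg fun j _ => hA i j).trans (hsum i)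
    -- Indices within `m` of `i` are still `n * m` away from the ends, so the induction hypothesis
    -- applies to them; the others carry mass at most `τ` and have `y ≤ 2`. With `t i ≤ τ` the total
    -- error is `3 * τ`.
    have h3 : ∑ j ∈ Finset.univ.erase i, A i j * y j ≤ δ i * b + τ * 2 := by
      rw [← Finset.sum_filter_add_sum_filter_not (Finset.univ.erase i)
        (fun j : Fin N => (i : ℕ) + m < j ∨ (j : ℕ) + m < i), add_comm]
      refine add_le_add ?_ ?_
      · calc _ ≤ ∑ j ∈ (Finset.univ.erase i).filter
              (fun j : Fin N => ¬ ((i : ℕ) + m < j ∨ (j : ℕ) + m < i)), A i j * b := by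
              refine Finset.sum_le_sum fun j hj => mul_le_mul_of_nonneg_left ?_ (hA i j)
              have hj2 := (Finset.mem_filter.1 hj).2
              exact ih j (by omega) (by omega)
          _ ≤ ∑ j ∈ Finset.univ.erase i, A i j * b :=
              Finset.sum_le_sum_of_subset_of_nonneg (Finset.filter_subset _ _)
                fun j _ _ => mul_nonneg (hA i j) hb0
          _ = (∑ j ∈ Finset.univ.erase i, A i j) * b := by rw [Finset.sum_mul]
          _ ≤ _ := mul_le_mul_of_nonneg_right (hsum i) hb0
      · calc _ ≤ ∑ j ∈ (Finset.univ.erase i).filter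
              (fun j : Fin N => (i : ℕ) + m < j ∨ (j : ℕ) + m < i), A i j * 2 :=
              Finset.sum_le_sum fun j _ => mul_le_mul_of_nonneg_left (hy j) (hA i j)
          _ = (∑ j ∈ (Finset.univ.erase i).filter
              (fun j : Fin N => (i : ℕ) + m < j ∨ (j : ℕ) + m < i), A i j) * 2 := by
              rw [Finset.sum_mul]
          _ ≤ _ := mul_le_mul_of_nonneg_right (hoff i) zero_le_two
    have h4 : (1 + δ i) * y i ≤ δ i * b + 3 * τ := by
      linarith [hle i, ht i (by omega) (by omega)]
    -- `δ / (1 + δ)` is increasing in `δ`, hence at most `r`.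
    have h5 : δ i * r ^ n ≤ (1 + δ i) * r ^ (n + 1) := by
      have : δ i ≤ (1 + δ i) * r := by
        rw [hr, mul_div_assoc', le_div_iff₀ (by linarith)]
        nlinarith [hδ i]
      calc δ i * r ^ n ≤ (1 + δ i) * r * r ^ n :=
            mul_le_mul_of_nonneg_right this (by positivity)
        _ = _ := by ring
    have h6 : (1 + δ i) * y i ≤ (1 + δ i) * (2 * r ^ (n + 1) + 3 * τ * (1 + Λ)) := by
      have : 0 ≤ τ * Λ := by positivity
      rw [hb] at h4
      nlinarith
    exact le_of_mul_le_mul_left h6 (by linarith)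

theorem sum_comp_add_sum_comp_le {ι κ : Type*} [DecidableEq κ] {f : κ → ℝ}
    (S T : Finset ι) (U : Finset κ) (φ ψ : ι → κ) (hf : ∀ k ∈ U, 0 ≤ f k)
    (hφ : Set.InjOn φ S) (hψ : Set.InjOn ψ T) (hS : ∀ i ∈ S, φ i ∈ U) (hT : ∀ i ∈ T, ψ i ∈ U)
    (hd : ∀ i ∈ S, ∀ j ∈ T, φ i ≠ ψ j) :
    ∑ i ∈ S, f (φ i) + ∑ i ∈ T, f (ψ i) ≤ ∑ k ∈ U, f k := by
  rw [← Finset.sum_image hφ, ← Finset.sum_image hψ, ← Finset.sum_union]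
  · refine Finset.sum_le_sum_of_subset_of_nonneg ?_ fun k hk _ => hf k hk
    intro k hk
    simp only [Finset.mem_union, Finset.mem_image] at hk
    rcases hk with ⟨i, hi, rfl⟩ | ⟨i, hi, rfl⟩
    exacts [hS i hi, hT i hi]
  · rw [Finset.disjoint_left]
    simp only [Finset.mem_image]
    rintro k ⟨i, hi, rfl⟩ ⟨j, hj, h⟩
    exact hd i hi j hj h.symm

/-! ### Grünwald coefficients -/

namespace TemperedFDE

open Filter Topology

theorem grunwald_eq_choose (β : ℝ) (k : ℕ) :
    grunwald β k = (-1) ^ k * Ring.choose β k := by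
  induction k with
  | zero => simp [grunwald]
  | succ k ih =>
    have h1 : (k + 1 : ℝ) * Ring.choose β (k + 1) = (β - k) * Ring.choose β k := by
      have h := Ring.choose_smul_choose β (Nat.le_succ k)
      simp only [Nat.succ_eq_add_one, Nat.choose_succ_self_right, nsmul_eq_mul,
        Nat.cast_add, Nat.cast_one, Nat.add_sub_cancel_left, Ring.choose_one_right] at h
      rw [h]; ring
    have hk : (k + 1 : ℝ) ≠ 0 := by positivity
    have h2 : Ring.choose β (k + 1) = (β - k) * Ring.choose β k / (k + 1) := by
      rw [eq_div_iff hk, mul_comm, h1]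
    rw [grunwald, ih, h2, pow_succ]
    field_simp
    ring

theorem hasSum_grunwald (β : ℝ) {z : ℝ} (h0 : 0 ≤ z) (h1 : z < 1) :
    HasSum (fun k => grunwald β k * z ^ k) ((1 - z) ^ β) := by
  have h := (Real.one_add_rpow_hasFPowerSeriesOnBall_zero (a := β)).hasSum (y := -z) (by
    simp [Metric.mem_eball, edist_eq_enorm_sub]
    rw [Real.enorm_eq_ofReal h0]
    simpa using h1)
  simp only [binomialSeries_apply, List.ofFn_const, List.prod_replicate, smul_eq_mul, zero_add] at h
  rw [← sub_eq_add_neg] at h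
  have e : (fun k => grunwald β k * z ^ k) = fun k => Ring.choose β k * (-z) ^ k := by
    ext k
    rw [grunwald_eq_choose, neg_pow z]
    ring
  rwa [e]

theorem grunwald_pos {β : ℝ} (h1 : 1 < β) (h2 : β < 2) (k : ℕ) : 0 < grunwald β (k + 2) := by
  induction k with
  | zero => simp [grunwald]; nlinarith
  | succ k ih =>
    rw [show k + 1 + 2 = k + 2 + 1 by ring, grunwald]
    refine mul_pos ?_ ih
    have : (0 : ℝ) ≤ k := k.cast_nonneg
    push_cast
    rw [sub_pos, div_lt_one (by linarith)]
    linarith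

theorem sum_grunwald_nonpos {β : ℝ} (h1 : 1 < β) (h2 : β < 2) (n : ℕ) :
    ∑ k ∈ Finset.range (n + 2), grunwald β k ≤ 0 := by
  -- The partial sums telescope to a closed form, whose sign is that of `-grunwald β (n + 1)`.
  have key : ∀ n : ℕ, β * ∑ k ∈ Finset.range (n + 1), grunwald β k =
      - ((n + 1) * grunwald β (n + 1)) := by
    intro n
    induction n with
    | zero => simp [grunwald]
    | succ n ih =>
      rw [Finset.sum_range_succ, mul_add, ih, show grunwald β (n + 1 + 1) =
        (1 - (1 + β) / (((n + 1 : ℕ) : ℝ) + 1)) * grunwald β (n + 1) from rfl]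
      have : (n + 1 + 1 : ℝ) ≠ 0 := by positivity
      push_cast
      field_simp
      ring
  have h3 := key (n + 1)
  have h4 := grunwald_pos h1 h2 n
  have : 0 ≤ ((n + 1 : ℕ) + 1 : ℝ) * grunwald β (n + 1 + 1) := by positivity
  by_contra! h
  nlinarith

theorem summable_grunwald {β : ℝ} (h1 : 1 < β) (h2 : β < 2) : Summable (grunwald β) := by
  rw [← summable_nat_add_iff 2]
  refine summable_of_sum_range_le (c := β - 1) (fun k => (grunwald_pos h1 h2 k).le) fun n => ?_
  have := sum_grunwald_nonpos h1 h2 n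
  rw [Finset.sum_range_succ', Finset.sum_range_succ'] at this
  rw [show grunwald β (0 + 1) = -β by simp [grunwald], grunwald] at this
  linarith

/-! ### Signs and generating function of the untempered weights -/

namespace Params

variable (p : Params)

/-- The untempered weights: the coefficients of `(γ₁ + γ₂ z + γ₃ z²) (1 - z)^β`. -/
noncomputable def weight : ℕ → ℝ
  | 0 => p.γ₁ * grunwald p.β 0
  | 1 => p.γ₁ * grunwald p.β 1 + p.γ₂ * grunwald p.β 0
  | k + 2 => p.γ₁ * grunwald p.β (k + 2) + p.γ₂ * grunwald p.β (k + 1) + p.γ₃ * grunwald p.β k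

variable {p}

/-- Eliminating `γ₂` and `γ₃` turns each of the three ranges into the same bounds on `γ₁`. In order,
they serve the signs of the weights from index 4 on, of `γ₁ + weight 2`, and of weight 3. -/
theorem Admissible.range_γ₁ (hp : p.Admissible) :
    2 * (p.β ^ 2 + 3 * p.β - 4) < p.γ₁ * (p.β ^ 2 + 3 * p.β + 2) ∧
    p.β ^ 2 + 3 * p.β < p.γ₁ * (p.β ^ 2 + 3 * p.β + 4) ∧
    2 * (p.γ₁ * (p.β ^ 2 + 3 * p.β + 2)) < 3 * (p.β ^ 2 + 3 * p.β - 2) := by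
  have hβ := hp.one_lt_β
  have h3 : p.γ₃ = p.γ₁ - p.β / 2 := by linarith [hp.diff_γ]
  have h2 : p.γ₂ = 1 + p.β / 2 - 2 * p.γ₁ := by linarith [hp.sum_γ]
  have e2 : 0 < p.β ^ 2 + 3 * p.β + 2 := by positivity
  have e4 : 0 < p.β ^ 2 + 3 * p.β + 4 := by positivity
  have f2 : 0 < 2 * (p.β ^ 2 + 3 * p.β + 2) := by positivity
  have f4 : 0 < 2 * (p.β ^ 2 + 3 * p.β + 4) := by positivity
  rcases hp.range_γ with h | h | h
  · rw [max_lt_iff, div_lt_iff₀ e2, div_lt_iff₀ e4, lt_div_iff₀ f2] at h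
    obtain ⟨⟨h, h'⟩, h''⟩ := h
    exact ⟨h, h', by linarith⟩
  · rw [lt_min_iff, lt_div_iff₀ f2, lt_div_iff₀ f4, div_lt_iff₀ f2, h2] at h
    obtain ⟨h, h', h''⟩ := h
    refine ⟨?_, ?_, ?_⟩ <;> linarith
  · rw [max_lt_iff, div_lt_iff₀ f2, div_lt_iff₀ f4, lt_div_iff₀ f2, h3] at h
    obtain ⟨⟨h, h'⟩, h''⟩ := h
    refine ⟨?_, ?_, ?_⟩ <;> linarith

theorem Admissible.γ₁_pos (hp : p.Admissible) : 0 < p.γ₁ := by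
  have hβ := hp.one_lt_β
  have h := hp.range_γ₁.2.1
  by_contra! h'
  nlinarith [sq_nonneg p.β]

/-- The recursion for the Grünwald coefficients turns a weight into a quadratic factor. -/
theorem Admissible.weight_eq (hp : p.Admissible) (k : ℕ) :
    ((k : ℝ) + 1) * (k + 2) * p.weight (k + 2) = grunwald p.β k *
      (p.γ₁ * (p.β ^ 2 + 3 * p.β + 2) -
        (k + 2) * ((p.β ^ 2 + 3 * p.β) / 2 - k)) := by
  have h3 : p.γ₃ = p.γ₁ - p.β / 2 := by linarith [hp.diff_γ]
  have h2 : p.γ₂ = 1 + p.β / 2 - 2 * p.γ₁ := by linarith [hp.sum_γ]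
  have e1 : ((k : ℝ) + 1) ≠ 0 := by positivity
  have e2 : ((k : ℝ) + 2) ≠ 0 := by positivity
  have e3 : ((k : ℝ) + 1 + 1) ≠ 0 := by positivity
  simp only [weight, grunwald, h2, h3]
  push_cast
  field_simp
  ring

theorem Admissible.weight_nonneg (hp : p.Admissible) (k : ℕ) : 0 ≤ p.weight (k + 3) := by
  have hβ := hp.one_lt_β
  have hβ' := hp.β_lt_two
  obtain ⟨r1, r2, r3⟩ := hp.range_γ₁
  have h := hp.weight_eq (k + 1)
  have hk0 : (0 : ℝ) ≤ k := k.cast_nonneg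
  have hpos : (0 : ℝ) < ((k + 1 : ℕ) + 1) * ((k + 1 : ℕ) + 2) := by positivity
  refine le_of_mul_le_mul_left ?_ hpos
  rw [mul_zero, show k + 3 = k + 1 + 2 by ring, h]
  -- Weight 3 carries the negative factor `grunwald β 1 = -β`, so it needs the upper bound on `γ₁`.
  -- Later weights need the lower bound, which is tight at weight 4; beyond it the quadratic factor
  -- only grows, since `β < 2`.
  rcases k with _ | k
  · simp only [grunwald]
    norm_num
    nlinarith
  · refine mul_nonneg (grunwald_pos hβ hβ' k).le ?_
    push_cast at *
    have hk1 : (0 : ℝ) ≤ k := k.cast_nonneg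
    nlinarith

theorem Admissible.weight_zero_add_two (hp : p.Admissible) : 0 ≤ p.γ₁ + p.weight 2 := by
  have h := hp.weight_eq 0
  have r := hp.range_γ₁.2.1
  simp [grunwald] at h
  linarith

theorem Admissible.summable_weight (hp : p.Admissible) : Summable p.weight := by
  rw [← summable_nat_add_iff 2]
  have h := summable_grunwald hp.one_lt_β hp.β_lt_two
  exact ((((summable_nat_add_iff 2).2 h).mul_left _).add
    (((summable_nat_add_iff 1).2 h).mul_left _)).add (h.mul_left _)

theorem hasSum_weight {z : ℝ} (h0 : 0 ≤ z) (h1 : z < 1) :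
    HasSum (fun k => p.weight k * z ^ k)
      ((p.γ₁ + p.γ₂ * z + p.γ₃ * z ^ 2) * (1 - z) ^ p.β) := by
  have h := hasSum_grunwald p.β h0 h1
  have hs1 := (hasSum_nat_add_iff' 1).2 h
  have hs2 := (hasSum_nat_add_iff' 2).2 h
  refine (hasSum_nat_add_iff' 2).1 ?_
  have h2 := ((hs2.mul_left p.γ₁).add (hs1.mul_left (p.γ₂ * z))).add
    (h.mul_left (p.γ₃ * z ^ 2))
  have e : (fun k => p.weight (k + 2) * z ^ (k + 2)) = fun k =>
      p.γ₁ * (grunwald p.β (k + 2) * z ^ (k + 2)) +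
        p.γ₂ * z * (grunwald p.β (k + 1) * z ^ (k + 1)) +
        p.γ₃ * z ^ 2 * (grunwald p.β k * z ^ k) := by
    ext k
    simp only [weight]
    ring
  rw [e]
  convert! h2 using 1
  simp [Finset.sum_range_succ, weight, grunwald]
  ring

/-- From index 3 on the weights are nonnegative, so truncation can only lower the sum of the series.
-/
theorem Admissible.sum_weight_le (hp : p.Admissible) {z : ℝ} (h0 : 0 ≤ z) (h1 : z ≤ 1) (n : ℕ) :
    ∑ k ∈ Finset.range (n + 3), p.weight k * z ^ k ≤
      (p.γ₁ + p.γ₂ * z + p.γ₃ * z ^ 2) * (1 - z) ^ p.β := by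
  have key : ∀ z : ℝ, 0 ≤ z → z < 1 → ∑ k ∈ Finset.range (n + 3), p.weight k * z ^ k ≤
      (p.γ₁ + p.γ₂ * z + p.γ₃ * z ^ 2) * (1 - z) ^ p.β := by
    intro z h0 h1
    refine sum_le_hasSum _ (fun k hk => ?_) (hasSum_weight h0 h1)
    obtain ⟨j, rfl⟩ : ∃ j, k = j + 3 := ⟨k - 3, by simp at hk; omega⟩
    exact mul_nonneg (hp.weight_nonneg j) (by positivity)
  rcases h1.lt_or_eq with h1 | rfl
  · exact key z h0 h1
  -- The endpoint `z = 1` is the untempered case `λ = 0`; it follows by letting `z` increase to 1.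
  · have hβ : 0 ≤ p.β := by linarith [hp.one_lt_β]
    have c1 : Continuous fun z : ℝ => ∑ k ∈ Finset.range (n + 3), p.weight k * z ^ k := by
      fun_prop
    have c2 : Continuous fun z : ℝ =>
        (p.γ₁ + p.γ₂ * z + p.γ₃ * z ^ 2) * (1 - z) ^ p.β :=
      (by fun_prop : Continuous fun z : ℝ => p.γ₁ + p.γ₂ * z + p.γ₃ * z ^ 2).mul
        ((Real.continuous_rpow_const hβ).comp (by fun_prop))
    refine le_of_tendsto_of_tendsto (b := 𝓝[<] (1 : ℝ))
      ((c1.tendsto 1).mono_left nhdsWithin_le_nhds)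
      ((c2.tendsto 1).mono_left nhdsWithin_le_nhds) ?_
    filter_upwards [Ioo_mem_nhdsLT (zero_lt_one (α := ℝ))] with z hz
    exact key z hz.1.le hz.2

/-! ### Tempered weights -/

theorem Admissible.h_pos (hp : p.Admissible) (N : ℕ) : 0 < p.h N :=
  div_pos (by linarith [hp.a_lt_b]) (by positivity)

theorem Admissible.h_mul_lam_nonneg (hp : p.Admissible) (N : ℕ) : 0 ≤ p.h N * p.lam :=
  mul_nonneg (hp.h_pos N).le hp.lam_nonneg

theorem Admissible.h_mul_lam_le (hp : p.Admissible) (N : ℕ) :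
    p.h N * p.lam ≤ (p.b - p.a) * p.lam :=
  mul_le_mul_of_nonneg_right
    (div_le_self (by linarith [hp.a_lt_b]) (by linarith [N.cast_nonneg (α := ℝ)])) hp.lam_nonneg

theorem g_eq_weight (N k : ℕ) :
    p.g N k = Real.exp (p.h N * p.lam) *
      (p.weight k * Real.exp (-(p.h N * p.lam)) ^ k) := by
  have e : ∀ y : ℝ, Real.exp (p.h N * p.lam) * (y * Real.exp (-(p.h N * p.lam)) ^ k) =
      y * Real.exp (-((k : ℝ) - 1) * p.h N * p.lam) := by
    intro y
    rw [← Real.exp_nat_mul, mul_left_comm, ← Real.exp_add]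
    congr 2
    ring
  rw [e]
  rcases k with _ | _ | k
  · simp [g, weight]
  · simp [g, weight]
  · simp only [g, weight]
    congr 2
    push_cast
    ring

theorem Admissible.g_nonneg (hp : p.Admissible) (N k : ℕ) : 0 ≤ p.g N (k + 3) := by
  rw [g_eq_weight]
  have := hp.weight_nonneg k
  positivity

/-- This majorant is independent of `N`, which makes the tail estimates uniform in the mesh. -/
theorem Admissible.g_le_weight (hp : p.Admissible) (N k : ℕ) :
    p.g N (k + 3) ≤ p.weight (k + 3) := by
  have hl := hp.h_mul_lam_nonneg N
  have hz : Real.exp (-(p.h N * p.lam)) ≤ 1 := by rw [Real.exp_le_one_iff]; linarith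
  have e : Real.exp (p.h N * p.lam) * Real.exp (-(p.h N * p.lam)) = 1 := by
    rw [← Real.exp_add]; simp
  rw [g_eq_weight, pow_succ, show ∀ a b c d : ℝ, a * (b * (c * d)) = b * (c * (a * d)) by
    intros; ring, e, mul_one]
  exact mul_le_of_le_one_right (hp.weight_nonneg k) (pow_le_one₀ (Real.exp_pos _).le hz)

theorem Admissible.g_zero_add_g_two_nonneg (hp : p.Admissible) (N : ℕ) :
    0 ≤ p.g N 0 + p.g N 2 := by
  have hl := hp.h_mul_lam_nonneg N
  have hz : Real.exp (-(p.h N * p.lam)) ≤ 1 := by rw [Real.exp_le_one_iff]; linarith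
  have hz0 := Real.exp_pos (-(p.h N * p.lam))
  have hE := Real.exp_pos (p.h N * p.lam)
  have h2 := hp.weight_zero_add_two
  have hγ := hp.γ₁_pos
  rw [g_eq_weight, g_eq_weight, ← mul_add]
  refine mul_nonneg hE.le ?_
  have hsq : Real.exp (-(p.h N * p.lam)) ^ 2 ≤ 1 := pow_le_one₀ hz0.le hz
  have : p.weight 0 = p.γ₁ := by simp [weight, grunwald]
  rw [this, pow_zero]
  nlinarith [sq_nonneg (Real.exp (-(p.h N * p.lam)))]

theorem Admissible.sum_g_le (hp : p.Admissible) (N n : ℕ) :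
    ∑ k ∈ Finset.range (n + 3), p.g N k ≤ p.ρ N := by
  have hl := hp.h_mul_lam_nonneg N
  have hz : Real.exp (-(p.h N * p.lam)) ≤ 1 := by rw [Real.exp_le_one_iff]; linarith
  have e : Real.exp (p.h N * p.lam) * Real.exp (-(p.h N * p.lam)) = 1 := by
    rw [← Real.exp_add]; simp
  simp only [g_eq_weight]
  rw [← Finset.mul_sum]
  refine (mul_le_mul_of_nonneg_left (hp.sum_weight_le (Real.exp_pos _).le hz n)
    (Real.exp_pos _).le).trans (le_of_eq ?_)
  rw [ρ, ← mul_assoc]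
  congr 1
  linear_combination (p.γ₂ + p.γ₃ * Real.exp (-(p.h N * p.lam))) * e

theorem Admissible.exists_ρ_sub_g_le (hp : p.Admissible) :
    ∃ L : ℝ, 0 < L ∧ ∀ N, p.ρ N - p.g N 1 ≤ L := by
  refine ⟨|p.γ₁| * Real.exp ((p.b - p.a) * p.lam) + |p.γ₂| + |p.γ₃| +
    |p.γ₁ * grunwald p.β 1 + p.γ₂ * grunwald p.β 0| + 1, by positivity, fun N => ?_⟩
  have hl := hp.h_mul_lam_nonneg N
  have hz : Real.exp (-(p.h N * p.lam)) ≤ 1 := by rw [Real.exp_le_one_iff]; linarith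
  have hz0 := Real.exp_pos (-(p.h N * p.lam))
  have hE : Real.exp (p.h N * p.lam) ≤ Real.exp ((p.b - p.a) * p.lam) :=
    Real.exp_le_exp.2 (hp.h_mul_lam_le N)
  have h1 : p.ρ N ≤ |p.γ₁| * Real.exp ((p.b - p.a) * p.lam) + |p.γ₂| + |p.γ₃| := by
    have hpow : (1 - Real.exp (-(p.h N * p.lam))) ^ p.β ≤ 1 :=
      Real.rpow_le_one (by linarith) (by linarith) (by linarith [hp.one_lt_β])
    have hpow0 : 0 ≤ (1 - Real.exp (-(p.h N * p.lam))) ^ p.β :=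
      Real.rpow_nonneg (by linarith) _
    have t1 : p.γ₁ * Real.exp (p.h N * p.lam) ≤ |p.γ₁| * Real.exp ((p.b - p.a) * p.lam) :=
      mul_le_mul (le_abs_self _) hE (Real.exp_pos _).le (abs_nonneg _)
    have t3 : p.γ₃ * Real.exp (-(p.h N * p.lam)) ≤ |p.γ₃| :=
      (mul_le_mul_of_nonneg_right (le_abs_self _) hz0.le).trans
        (mul_le_of_le_one_right (abs_nonneg _) hz)
    rw [ρ]
    refine (mul_le_mul_of_nonneg_right ?_ hpow0).trans
      (mul_le_of_le_one_right (by positivity) hpow)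
    linarith [le_abs_self p.γ₂]
  have h2 := neg_abs_le (p.γ₁ * grunwald p.β 1 + p.γ₂ * grunwald p.β 0)
  simp only [g]
  linarith

/-! ### Toeplitz and Hankel parts of a row -/

variable (p) in
/-- The off-diagonal symbol: the entry of `G` at distance `k ≥ 1` from the diagonal is
`-Δt / (2 h^β)` times `symb k`. -/
noncomputable def symb (N k : ℕ) : ℝ :=
  if k = 1 then p.g N 0 + p.g N 2 else p.g N (k + 1)

theorem Admissible.symb_nonneg (hp : p.Admissible) (N : ℕ) {k : ℕ} (hk : 1 ≤ k) :
    0 ≤ p.symb N k := by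
  rw [symb]
  split_ifs with h
  · exact hp.g_zero_add_g_two_nonneg N
  · obtain ⟨j, rfl⟩ : ∃ j, k = j + 2 := ⟨k - 2, by omega⟩
    exact hp.g_nonneg N j

theorem Admissible.symb_le_weight (hp : p.Admissible) (N : ℕ) {k : ℕ} (hk : 2 ≤ k) :
    p.symb N k ≤ p.weight (k + 1) := by
  rw [symb, if_neg (by omega)]
  obtain ⟨j, rfl⟩ : ∃ j, k = j + 2 := ⟨k - 2, by omega⟩
  exact hp.g_le_weight N j

theorem Admissible.sum_symb_le (hp : p.Admissible) (N n : ℕ) :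
    ∑ k ∈ Finset.Ico 1 (n + 1), p.symb N k ≤ p.ρ N - p.g N 1 := by
  have key : ∀ n : ℕ, ∑ k ∈ Finset.Ico 1 (n + 2), p.symb N k =
      ∑ k ∈ Finset.range (n + 3), p.g N k - p.g N 1 := by
    intro n
    induction n with
    | zero => simp [Finset.sum_range_succ, symb]; ring
    | succ n ih =>
      rw [Finset.sum_Ico_succ_top (by omega), ih, Finset.sum_range_succ _ (n + 3), symb,
        if_neg (by omega)]
      ring
  calc _ ≤ ∑ k ∈ Finset.Ico 1 (n + 2), p.symb N k :=
        Finset.sum_le_sum_of_subset_of_nonneg (Finset.Ico_subset_Ico_right (by omega))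
          fun k hk _ => hp.symb_nonneg N (Finset.mem_Ico.1 hk).1
    _ ≤ _ := by rw [key]; linarith [hp.sum_g_le N n]

variable (p) in
/-- The nonnegative Hankel weights: `HC` is `-Δt / (2 h^β)` times this matrix. -/
noncomputable def hankel (N : ℕ) (i j : Fin N) : ℝ :=
  if (i : ℕ) + j + 2 < N then p.symb N (i + j + 2)
  else if N < (i : ℕ) + j then p.symb N (2 * N - (i + j)) else 0

variable (p) in
/-- The off-diagonal weights of the Toeplitz matrix `G`. -/
noncomputable def toep (N : ℕ) (i j : Fin N) : ℝ :=
  if i = j then 0 else p.symb N ((i - j : ℕ) + (j - i : ℕ))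

theorem Admissible.hankel_nonneg (hp : p.Admissible) (N : ℕ) (i j : Fin N) :
    0 ≤ p.hankel N i j := by
  have := i.2
  have := j.2
  rw [hankel]
  split_ifs
  · exact hp.symb_nonneg N (by omega)
  · exact hp.symb_nonneg N (by omega)
  · exact le_rfl

theorem Admissible.toep_nonneg (hp : p.Admissible) (N : ℕ) (i j : Fin N) :
    0 ≤ p.toep N i j := by
  rw [toep]
  split_ifs with h
  · exact le_rfl
  · have : (i : ℕ) ≠ j := fun h' => h (Fin.ext h')
    exact hp.symb_nonneg N (by omega)

/-- On each side of the diagonal the Toeplitz and the Hankel weights of a row are distinct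
terms of the symbol. -/
theorem Admissible.sum_toep_add_hankel_le (hp : p.Admissible) {N : ℕ} (m : ℕ) (i : Fin N)
    (S T : Finset (Fin N)) (hS : ∀ j ∈ S, (i : ℕ) + m < j ∨ (j : ℕ) + m < i)
    (hT : ∀ j ∈ T, m ≤ (i : ℕ) + j + 1 ∧ m + (i + j : ℕ) < 2 * N) :
    ∑ j ∈ S, p.toep N i j + ∑ j ∈ T, p.hankel N i j ≤
      2 * ∑ k ∈ Finset.Ico (m + 1) (N + 1), p.symb N k := by
  have hi := i.2
  have hU : ∀ k ∈ Finset.Ico (m + 1) (N + 1), 0 ≤ p.symb N k := fun k hk =>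
    hp.symb_nonneg N (by have := (Finset.mem_Ico.1 hk).1; omega)
  -- The index sets are disjoint: `i - j ≤ i < i + 2 ≤ i + j' + 2`.
  have left := sum_comp_add_sum_comp_le (f := p.symb N)
    (S.filter fun j : Fin N => (j : ℕ) < i) (T.filter fun j : Fin N => (i : ℕ) + j + 2 < N)
    (Finset.Ico (m + 1) (N + 1)) (fun j => (i : ℕ) - j) (fun j => (i : ℕ) + j + 2) hU
    (fun a ha b hb h => by
      simp only [Finset.coe_filter, Set.mem_ofPred_eq] at ha hb h
      exact Fin.ext (by omega))
    (fun a ha b hb h => by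
      simp only at h
      exact Fin.ext (by omega))
    (fun j hj => by
      obtain ⟨h1, h2⟩ := Finset.mem_filter.1 hj
      have := hS j h1
      rw [Finset.mem_Ico]; omega)
    (fun j hj => by
      obtain ⟨h1, h2⟩ := Finset.mem_filter.1 hj
      have := hT j h1
      rw [Finset.mem_Ico]; omega)
    (fun a ha b hb => by omega)
  -- Here `j - i ≤ N - 1 - i < N + 1 - i ≤ 2 * N - (i + j')`.
  have right := sum_comp_add_sum_comp_le (f := p.symb N)
    (S.filter fun j : Fin N => ¬ (j : ℕ) < i)
    ((T.filter fun j : Fin N => ¬ (i : ℕ) + j + 2 < N).filter fun j : Fin N => N < (i : ℕ) + j)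
    (Finset.Ico (m + 1) (N + 1)) (fun j => (j : ℕ) - i) (fun j => 2 * N - ((i : ℕ) + j)) hU
    (fun a ha b hb h => by
      simp only [Finset.coe_filter, Set.mem_ofPred_eq] at ha hb h
      exact Fin.ext (by omega))
    (fun a ha b hb h => by
      have := a.2
      have := b.2
      simp only at h
      exact Fin.ext (by omega))
    (fun j hj => by
      have := j.2
      obtain ⟨h1, h2⟩ := Finset.mem_filter.1 hj
      have := hS j h1
      rw [Finset.mem_Ico]; omega)
    (fun j hj => by
      have := j.2
      obtain ⟨h1, h2⟩ := Finset.mem_filter.1 hj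
      have := hT j (Finset.mem_filter.1 h1).1
      rw [Finset.mem_Ico]; omega)
    (fun a ha b hb => by
      have := a.2
      have := b.2
      have h1 := (Finset.mem_filter.1 ha).2
      have h2 := (Finset.mem_filter.1 hb).2
      omega)
  have e1 : ∑ j ∈ S, p.toep N i j =
      ∑ j ∈ S.filter (fun j : Fin N => (j : ℕ) < i), p.symb N ((i : ℕ) - j) +
      ∑ j ∈ S.filter (fun j : Fin N => ¬ (j : ℕ) < i), p.symb N ((j : ℕ) - i) := by
    rw [← Finset.sum_filter_add_sum_filter_not S (fun j : Fin N => (j : ℕ) < i)]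
    congr 1 <;> refine Finset.sum_congr rfl fun j hj => ?_
    · obtain ⟨h1, h2⟩ := Finset.mem_filter.1 hj
      rw [toep, if_neg (fun h => by subst h; omega)]
      congr 1; omega
    · obtain ⟨h1, h2⟩ := Finset.mem_filter.1 hj
      have := hS j h1
      rw [toep, if_neg (fun h => by subst h; omega)]
      congr 1; omega
  have e2 : ∑ j ∈ T, p.hankel N i j =
      ∑ j ∈ T.filter (fun j : Fin N => (i : ℕ) + j + 2 < N), p.symb N ((i : ℕ) + j + 2) +
      ∑ j ∈ (T.filter fun j : Fin N => ¬ (i : ℕ) + j + 2 < N).filter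
        (fun j : Fin N => N < (i : ℕ) + j), p.symb N (2 * N - ((i : ℕ) + j)) := by
    rw [← Finset.sum_filter_add_sum_filter_not T (fun j : Fin N => (i : ℕ) + j + 2 < N)]
    congr 1
    · refine Finset.sum_congr rfl fun j hj => ?_
      rw [hankel, if_pos (Finset.mem_filter.1 hj).2]
    · rw [Finset.sum_filter (fun j : Fin N => N < (i : ℕ) + j)]
      refine Finset.sum_congr rfl fun j hj => ?_
      rw [hankel, if_neg (Finset.mem_filter.1 hj).2]
  rw [e1, e2]
  linarith

theorem Admissible.exists_tail_le (hp : p.Admissible) {τ : ℝ} (hτ : 0 < τ) :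
    ∃ m : ℕ, ∀ N n : ℕ, 2 * ∑ k ∈ Finset.Ico (m + 1) n, p.symb N k ≤ τ := by
  obtain ⟨s, hs⟩ := summable_iff_vanishing_norm.1
    ((summable_nat_add_iff 1).2 hp.summable_weight) (τ / 2) (by positivity)
  obtain ⟨m, hm⟩ : ∃ m, ∀ k ∈ s, k ≤ m := ⟨s.sup id, fun k hk => Finset.le_sup (f := id) hk⟩
  -- The extra 1 forces `k ≥ 2`, avoiding the exceptional term `symb N 1`.
  refine ⟨m + 1, fun N n => ?_⟩
  have h1 := hs (Finset.Ico (m + 1 + 1) n) (by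
    rw [Finset.disjoint_left]
    intro k hk hk'
    have := hm k hk'
    have := (Finset.mem_Ico.1 hk).1
    omega)
  have h2 : ∑ k ∈ Finset.Ico (m + 1 + 1) n, p.symb N k ≤
      ∑ k ∈ Finset.Ico (m + 1 + 1) n, p.weight (k + 1) :=
    Finset.sum_le_sum fun k hk => hp.symb_le_weight N (by
      have := (Finset.mem_Ico.1 hk).1
      omega)
  have h3 := (le_abs_self _).trans_lt h1
  linarith

/-! ### Diagonal dominance of `K_i` and `G_i` -/

variable (p) in
/-- The factor `d_i Δt / (2 h^β)` in front of the weights in `K_i` and `G_i`. -/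
noncomputable def scale (d : ℝ → ℝ) (N M : ℕ) (i : Fin N) : ℝ :=
  d (p.x N i) * (p.dt M / (2 * p.h N ^ p.β))

theorem K_apply (d : ℝ → ℝ) (N M : ℕ) (i a b : Fin N) :
    p.K d N M i a b = (if a = b then 1 + 2 * p.scale d N M i * (p.ρ N - p.g N 1) else 0) -
      p.scale d N M i * p.toep N a b := by
  simp only [K, G, Gβ, scale, toep, Matrix.add_apply, Matrix.smul_apply, Matrix.transpose_apply,
    Matrix.of_apply, Matrix.one_apply, smul_eq_mul]
  by_cases hab : a = b
  · subst hab
    simp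
    ring
  · have hab' : (a : ℕ) ≠ b := fun h => hab (Fin.ext h)
    simp only [hab, if_false, Ne.symm hab, sub_zero, symb]
    rcases lt_or_gt_of_ne hab' with h | h
    · by_cases h1 : (b : ℕ) = a + 1
      · rw [if_pos (by omega), if_pos (by omega), if_pos (by omega), h1,
          Nat.sub_self, show (a : ℕ) + 1 + 1 - a = 2 by omega]
        ring
      · rw [if_neg (by omega), if_pos (by omega), if_neg (by omega),
          show (a : ℕ) - b + (b - a) + 1 = b + 1 - a by omega]
        ring
    · by_cases h1 : (a : ℕ) = b + 1
      · rw [if_pos (by omega), if_pos (by omega), if_pos (by omega), h1,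
          Nat.sub_self, show (b : ℕ) + 1 + 1 - b = 2 by omega]
        ring
      · rw [if_pos (by omega), if_neg (by omega), if_neg (by omega),
          show (a : ℕ) - b + (b - a) + 1 = a + 1 - b by omega]
        ring

theorem Gtau_apply (d : ℝ → ℝ) (N M : ℕ) (i a b : Fin N) :
    p.Gtau d N M i a b = p.K d N M i a b + p.scale d N M i * p.hankel N a b := by
  have h : p.HC N M a b = -(p.dt M / (2 * p.h N ^ p.β)) * p.hankel N a b := by
    have := a.2
    have := b.2
    simp only [HC, Matrix.of_apply, hankel, symb]
    congr 1
    split_ifs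
    any_goals omega
    · rfl
    · congr 1; omega
    · rfl
  simp only [Gtau, K, tauG, Matrix.add_apply, Matrix.smul_apply, Matrix.sub_apply, h, scale,
    smul_eq_mul]
  ring

/-- The weights of a row of `G` and of `HC` together do not exceed the diagonal. -/
theorem Admissible.row_le (hp : p.Admissible) {N : ℕ} (i : Fin N) :
    ∑ j ∈ Finset.univ.erase i, (p.toep N i j + p.hankel N i j) ≤
      2 * (p.ρ N - p.g N 1) := by
  have hi := i.2
  rw [Finset.sum_add_distrib]
  refine (hp.sum_toep_add_hankel_le 0 i _ _ (fun j hj => ?_) (fun j _ => ?_)).trans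
    (mul_le_mul_of_nonneg_left (hp.sum_symb_le N N) zero_le_two)
  · have : (j : ℕ) ≠ i := fun h => (Finset.mem_erase.1 hj).1 (Fin.ext h)
    omega
  · have := j.2
    omega

section

variable {d : ℝ → ℝ} {N M : ℕ} {i : Fin N}

/-- Including the Hankel weight, superfluous for `K_i`, gives one majorant for both matrices. -/
theorem abs_K_apply_le (hp : p.Admissible) (hs : 0 ≤ p.scale d N M i) {a b : Fin N}
    (hab : b ≠ a) :
    |p.K d N M i a b| ≤ p.scale d N M i * (p.toep N a b + p.hankel N a b) := by
  have h1 := mul_nonneg hs (hp.toep_nonneg N a b)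
  have h2 := mul_nonneg hs (hp.hankel_nonneg N a b)
  rw [K_apply, if_neg hab.symm, abs_le, mul_add]
  constructor <;> linarith

theorem abs_Gtau_apply_le (hp : p.Admissible) (hs : 0 ≤ p.scale d N M i) {a b : Fin N}
    (hab : b ≠ a) :
    |p.Gtau d N M i a b| ≤ p.scale d N M i * (p.toep N a b + p.hankel N a b) := by
  have h1 := mul_nonneg hs (hp.toep_nonneg N a b)
  have h2 := mul_nonneg hs (hp.hankel_nonneg N a b)
  rw [Gtau_apply, K_apply, if_neg hab.symm, abs_le, mul_add]
  constructor <;> linarith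

theorem scale_row_le (hp : p.Admissible) (hs : 0 ≤ p.scale d N M i) (a : Fin N) :
    ∑ j ∈ Finset.univ.erase a, p.scale d N M i * (p.toep N a j + p.hankel N a j) ≤
      2 * p.scale d N M i * (p.ρ N - p.g N 1) := by
  rw [← Finset.mul_sum, mul_comm 2, mul_assoc]
  exact mul_le_mul_of_nonneg_left (hp.row_le a) hs

theorem K_diag (a : Fin N) :
    p.K d N M i a a = 1 + 2 * p.scale d N M i * (p.ρ N - p.g N 1) := by
  rw [K_apply, if_pos rfl, toep, if_pos rfl]
  ring

/-- The Hankel part only increases the diagonal, so the diagonal of `K_i` serves as a lower bound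
for both. -/
theorem K_diag_le_Gtau_diag (hp : p.Admissible) (hs : 0 ≤ p.scale d N M i) (a : Fin N) :
    p.K d N M i a a ≤ p.Gtau d N M i a a := by
  rw [Gtau_apply]
  linarith [mul_nonneg hs (hp.hankel_nonneg N a a)]

theorem K_diag_dominant (hp : p.Admissible) (hs : 0 ≤ p.scale d N M i) (a : Fin N) :
    1 + ∑ b ∈ Finset.univ.erase a, |p.K d N M i a b| ≤ p.K d N M i a a := by
  rw [K_diag]
  gcongr
  exact (Finset.sum_le_sum fun b hb => abs_K_apply_le hp hs (Finset.mem_erase.1 hb).1).trans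
    (scale_row_le hp hs a)

theorem Gtau_diag_dominant (hp : p.Admissible) (hs : 0 ≤ p.scale d N M i) (a : Fin N) :
    1 + ∑ b ∈ Finset.univ.erase a, |p.Gtau d N M i a b| ≤ p.Gtau d N M i a a := by
  refine le_trans ?_ (K_diag_le_Gtau_diag hp hs a)
  rw [K_diag]
  gcongr
  exact (Finset.sum_le_sum fun b hb => abs_Gtau_apply_le hp hs (Finset.mem_erase.1 hb).1).trans
    (scale_row_le hp hs a)

theorem rowSum_inv_sub_inv_le_two (hp : p.Admissible) (hs : 0 ≤ p.scale d N M i) (a : Fin N) :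
    ∑ j, |((p.Gtau d N M i)⁻¹ - (p.K d N M i)⁻¹) a j| ≤ 2 := by
  have h1 := rowSum_inv_le_one (Gtau_diag_dominant hp hs) a
  have h2 := rowSum_inv_le_one (K_diag_dominant hp hs) a
  calc _ ≤ ∑ j, (|(p.Gtau d N M i)⁻¹ a j| + |(p.K d N M i)⁻¹ a j|) :=
        Finset.sum_le_sum fun j _ => by rw [Matrix.sub_apply]; exact abs_sub _ _
    _ ≤ 2 := by rw [Finset.sum_add_distrib]; linarith

theorem Gtau_mul_inv_sub_inv (hp : p.Admissible) (hs : 0 ≤ p.scale d N M i) :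
    p.Gtau d N M i * ((p.Gtau d N M i)⁻¹ - (p.K d N M i)⁻¹) =
      (p.K d N M i - p.Gtau d N M i) * (p.K d N M i)⁻¹ := by
  have h1 := (Matrix.isUnit_iff_isUnit_det _).1
    (isUnit_of_diag_dominant (Gtau_diag_dominant hp hs))
  have h2 := (Matrix.isUnit_iff_isUnit_det _).1
    (isUnit_of_diag_dominant (K_diag_dominant hp hs))
  rw [Matrix.mul_sub, Matrix.sub_mul, Matrix.mul_nonsing_inv _ h1, Matrix.mul_nonsing_inv _ h2]

end

/-! ### Uniform smallness in the interior -/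

/-- The rows of `G_i⁻¹ - K_i⁻¹` away from the boundary are small, uniformly in the mesh. -/
theorem Admissible.exists_interior_rowSum_lt (hp : p.Admissible) {C : ℝ} (hC : 0 ≤ C)
    {ε : ℝ} (hε : 0 < ε) :
    ∃ R : ℕ, ∀ (d : ℝ → ℝ) (N M : ℕ) (i : Fin N), 0 ≤ p.scale d N M i →
      p.scale d N M i ≤ C → ∀ a : Fin N, R ≤ (a : ℕ) → (a : ℕ) + R < N →
        ∑ j, |((p.Gtau d N M i)⁻¹ - (p.K d N M i)⁻¹) a j| < ε := by
  obtain ⟨L, hL0, hL⟩ := hp.exists_ρ_sub_g_le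
  set Λ := 2 * C * L with hΛdef
  have hΛ : 0 ≤ Λ := by positivity
  -- `ε` is split evenly: `3 * τ * (1 + Λ) = ε / 2`, and below `2 * (Λ / (1 + Λ)) ^ n < ε / 2`. The
  -- tail is taken below `τ / (C + 1)` to absorb the factor `s ≤ C`.
  obtain ⟨τ, hτ0, hτ⟩ : ∃ τ : ℝ, 0 < τ ∧ 3 * τ * (1 + Λ) = ε / 2 :=
    ⟨ε / 2 / (3 * (1 + Λ)), by positivity, by field_simp⟩
  obtain ⟨m, hm⟩ := hp.exists_tail_le (τ := τ / (C + 1)) (by positivity)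
  obtain ⟨n, hn⟩ := exists_pow_lt_of_lt_one (show 0 < ε / 4 by positivity)
    (show Λ / (1 + Λ) < 1 by rw [div_lt_one (by positivity)]; linarith)
  refine ⟨n * m, fun d N M i hs hsC a ha ha' => ?_⟩
  set s := p.scale d N M i with hsdef
  have hsτ : ∀ x : ℝ, x ≤ τ / (C + 1) → s * x ≤ τ := fun x hx => by
    calc s * x ≤ s * (τ / (C + 1)) := mul_le_mul_of_nonneg_left hx hs
      _ ≤ (C + 1) * (τ / (C + 1)) :=
          mul_le_mul_of_nonneg_right (by linarith) (by positivity)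
      _ = τ := by field_simp
  -- The empty sum of symbols.
  have hdiag : 0 ≤ p.ρ N - p.g N 1 := by simpa using hp.sum_symb_le N 0
  have main := interior_decay hΛ hτ0.le (m := m)
    (A := fun a b => s * (p.toep N a b + p.hankel N a b))
    (δ := fun _ => 2 * s * (p.ρ N - p.g N 1))
    (y := fun a => ∑ j, |((p.Gtau d N M i)⁻¹ - (p.K d N M i)⁻¹) a j|)
    (t := fun a => s * ∑ j, p.hankel N a j)
    (fun a b => mul_nonneg hs (add_nonneg (hp.toep_nonneg N a b) (hp.hankel_nonneg N a b)))
    (fun _ => by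
      have h1 : s * (p.ρ N - p.g N 1) ≤ C * L := mul_le_mul hsC (hL N) hdiag hC
      simp only [hΛdef]
      linarith)
    (rowSum_inv_sub_inv_le_two hp hs)
    (scale_row_le hp hs)
    (fun a => by
      rw [← Finset.mul_sum, Finset.sum_add_distrib]
      refine hsτ _ ((hp.sum_toep_add_hankel_le m a _ _ (fun j hj => (Finset.mem_filter.1 hj).2)
        (fun j hj => ?_)).trans (hm N _))
      have := (Finset.mem_filter.1 hj).2
      have := a.2
      have := j.2
      omega)
    -- In a row at distance `m` from both ends, every nonzero Hankel weight is a symbol of index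
    -- above `m`.
    (fun a h1 h2 => by
      refine hsτ _ (le_trans ?_ ((hp.sum_toep_add_hankel_le m a ∅ Finset.univ (by simp)
        (fun j _ => ?_)).trans (hm N _)))
      · simp
      · have := j.2
        omega)
    (fun a => by
      have h1 := diag_mul_rowSum_le (Gtau_mul_inv_sub_inv hp hs) a
      have h2 := rowSum_mul_le (A := p.K d N M i - p.Gtau d N M i)
        (rowSum_inv_le_one (K_diag_dominant hp hs)) a
      have h3 : ∑ j, |(p.K d N M i - p.Gtau d N M i) a j| = s * ∑ j, p.hankel N a j := by
        rw [Finset.mul_sum]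
        refine Finset.sum_congr rfl fun j _ => ?_
        rw [Matrix.sub_apply, Gtau_apply, sub_add_cancel_left, abs_neg,
          abs_of_nonneg (mul_nonneg hs (hp.hankel_nonneg N a j))]
      have hy : 0 ≤ ∑ j, |((p.Gtau d N M i)⁻¹ - (p.K d N M i)⁻¹) a j| :=
        Finset.sum_nonneg fun _ _ => abs_nonneg _
      have h4 := mul_le_mul_of_nonneg_right (K_diag_le_Gtau_diag hp hs a) hy
      rw [K_diag] at h4
      refine h4.trans (h1.trans (add_le_add ?_ (h2.trans h3.le)))
      exact Finset.sum_le_sum fun b hb => mul_le_mul_of_nonneg_right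
        (abs_Gtau_apply_le hp hs (Finset.mem_erase.1 hb).1)
        (Finset.sum_nonneg fun _ _ => abs_nonneg _))
    n a ha ha'
  refine main.trans_lt ?_
  linarith

end Params

end TemperedFDE

/-! ### Splitting into small norm and low rank -/

theorem theorem4p1 (p : TemperedFDE.Params) (hp : p.Admissible) (C : ℝ) :
    ∃ c₂ : ℝ, 0 < c₂ ∧ ∀ ε : ℝ, 0 < ε → ∃ ς : ℕ,
      ∀ N M : ℕ, 1 ≤ N → 1 ≤ M →
      ∀ d : ℝ → ℝ, (∀ y ∈ Set.Icc p.a p.b, 0 ≤ d y) →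
        (∀ i : Fin N, d (p.x N i) * (p.dt M / p.h N ^ p.β) ≤ C) →
        (∀ i : Fin N, IsUnit (p.K d N M i)) ∧
        (∀ i : Fin N, IsUnit (p.Gtau d N M i)) ∧
        ∃ E₂ F₂ : Matrix (Fin N) (Fin N) ℝ,
          p.P₂inv d N M - p.P₁inv d N M = E₂ + F₂ ∧
          ‖E₂‖ < c₂ * ε ∧
          F₂.rank ≤ 4 * ς := by
  refine ⟨1, one_pos, fun ε hε => ?_⟩
  obtain ⟨R, hR⟩ := hp.exists_interior_rowSum_lt (abs_nonneg C) hε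
  refine ⟨R, fun N M _ _ d hd hC => ?_⟩
  have hh := hp.h_pos N
  have hdt : 0 ≤ p.dt M := div_nonneg hp.T_pos.le M.cast_nonneg
  have hx : ∀ i : Fin N, p.x N i ∈ Set.Icc p.a p.b := by
    intro i
    have hN : ((i : ℕ) : ℝ) + 1 ≤ (N : ℝ) + 1 := by exact_mod_cast Nat.succ_le_succ i.2.le
    have hmul : ((N : ℝ) + 1) * p.h N = p.b - p.a := by
      have : (N : ℝ) + 1 ≠ 0 := by positivity
      rw [TemperedFDE.Params.h]
      field_simp
    have := mul_le_mul_of_nonneg_right hN hh.le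
    have h0 : 0 ≤ (((i : ℕ) : ℝ) + 1) * p.h N := by positivity
    rw [TemperedFDE.Params.x]
    constructor <;> linarith
  have hs0 : ∀ i, 0 ≤ p.scale d N M i := fun i => mul_nonneg (hd _ (hx i)) (by positivity)
  -- The scale is half of the quantity bounded by `C`; the absolute value supplies the nonnegative
  -- bound needed for `R`.
  have hs1 : ∀ i, p.scale d N M i ≤ |C| := by
    intro i
    have e : p.scale d N M i = d (p.x N i) * (p.dt M / p.h N ^ p.β) / 2 := by
      rw [TemperedFDE.Params.scale]
      field_simp
    have := hs0 i
    linarith [hC i, le_abs_self C]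
  refine ⟨fun i => isUnit_of_diag_dominant (TemperedFDE.Params.K_diag_dominant hp (hs0 i)),
    fun i => isUnit_of_diag_dominant (TemperedFDE.Params.Gtau_diag_dominant hp (hs0 i)), ?_⟩
  set Δ := p.P₂inv d N M - p.P₁inv d N M with hΔ
  have hrow : ∀ i j, Δ i j = ((p.Gtau d N M i)⁻¹ - (p.K d N M i)⁻¹) i j := by
    intro i j
    rw [hΔ, Matrix.sub_apply, TemperedFDE.Params.P₂inv, TemperedFDE.Params.P₁inv,
      sum_vecMulVec_single_mul_apply, sum_vecMulVec_single_mul_apply, Matrix.sub_apply]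
  set B := Finset.univ.filter fun i : Fin N => (i : ℕ) < R ∨ N ≤ (i : ℕ) + R with hB
  refine ⟨Matrix.of fun i j => if i ∈ B then 0 else Δ i j,
    Matrix.of fun i j => if i ∈ B then Δ i j else 0, ?_, ?_, ?_⟩
  · ext i j
    by_cases hi : i ∈ B <;> simp [hi]
  · rw [one_mul]
    refine linfty_opNorm_lt hε fun i => ?_
    by_cases hi : i ∈ B
    · simpa [hi] using hε
    · have hi' : ¬ ((i : ℕ) < R ∨ N ≤ (i : ℕ) + R) := by simpa [hB] using hi
      simp only [Matrix.of_apply, hi, if_false, hrow]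
      exact hR d N M i (hs0 i) (hs1 i) i (by omega) (by omega)
  · refine (rank_le_card_of_rows_eq_zero B fun i hi j => by simp [hi]).trans ?_
    have : B.card ≤ 2 * R := card_fin_near_boundary N R
    omega
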